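/- For $n\ge 1$ let $E_n$ denote the Euler number, that is, the number of alternating permutations of $[n]=\{1,\dots,n\}$: permutations $\pi$ with $\pi(1)>\pi(2)<\pi(3)>\pi(4)<\cdots\pi(n)$. For a real sequence $\{a_i\}_{i\ge s}$ let $\mathcal L\{a_i\}_{i\ge s}$ be the sequence $\{a_{i-1}a_{i+1}-a_i^2\}_{i\ge s+1}$, and call $\{a_i\}$ $k$-log-convex if all terms of $\mathcal L^m\{a_i\}$ are nonnegative for every $0\le m\le k$. **Proposition 4.2 (Euler numbers).** The sequence $\{E_{n+1}\}_{n\ge 0}=(E_1,E_2,E_3,\dots)$ of Euler numbers is $2$-log-convex. -/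

import Mathlib

namespace EulerLogConvex

/-- A permutation `π` of the `n`-element set is alternating if
`π(1) > π(2) < π(3) > π(4) < ⋯`. Positions are numbered from `0` here, so there is a descent
after each even position and an ascent after each odd position. -/
def IsAlternating {n : ℕ} (π : Equiv.Perm (Fin n)) : Prop :=
  ∀ i j : Fin n, (j : ℕ) = (i : ℕ) + 1 →
    (Even (i : ℕ) → π j < π i) ∧ (Odd (i : ℕ) → π i < π j)

/-- The Euler number `E n`: the number of alternating permutations of an `n`-element set. -/
noncomputable def eulerNumber (n : ℕ) : ℕ :=
  Nat.card {π : Equiv.Perm (Fin n) // IsAlternating π}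

/-- The operator `a ↦ (a (i - 1) * a (i + 1) - a i ^ 2)` for `i ≥ 1`, the resulting sequence
being renumbered so that it starts at index `0`. -/
def logConvexOp (a : ℕ → ℝ) : ℕ → ℝ :=
  fun n => a n * a (n + 2) - a (n + 1) ^ 2

/-- A real sequence is `k`-log-convex if it and its images under the first `k` iterates of
`logConvexOp` all have nonnegative terms. -/
def IsKLogConvex (k : ℕ) (a : ℕ → ℝ) : Prop :=
  ∀ m ≤ k, ∀ n : ℕ, 0 ≤ (logConvexOp^[m] a) n

end EulerLogConvex

/-! The exponential generating function of `E_n` is `sec x + tan x = cot (π/4 - x/2)`, whose poles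
lie at `π/2` times `1, 5, 9, …` and `-3, -7, …`. Expanding the cotangent over its poles gives `E_n /
n! = (4/π) (2/π)^n c_n`, where `c_n = 1 + O(3^(-n))` because the pole at `π/2` dominates.

After removing positive factors, the first defect becomes `D_n = (n+3) c_(n+1) c_(n+3) - (n+2)
c_(n+2)^2`, close to 1, and the second becomes `(n+4) D_n D_(n+2) - (n+2) D_(n+1)^2`, close to 2.
Explicit error bounds give positivity for `n ≥ 6`; the remaining terms need only `E_1, …, E_10`,
computed from the Entringer recurrence.

The generating function (`eulerSeries_mul_cos`) comes from the same recurrence: with signs, the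
Entringer triangle is a binomial-transform array. Comparison with the pole expansion is
`eulerNumber_eq`. -/

namespace EulerLogConvex

/-! ### Entringer recurrence for alternating permutations -/

/-- A permutation `π` is reverse alternating if `π(1) < π(2) > π(3) < π(4) > ⋯`. -/
def IsReverseAlternating {n : ℕ} (π : Equiv.Perm (Fin n)) : Prop :=
  ∀ i j : Fin n, (j : ℕ) = (i : ℕ) + 1 →
    (Even (i : ℕ) → π i < π j) ∧ (Odd (i : ℕ) → π j < π i)

/-- The permutation with first value `k` whose remaining values are in the same relative order
as those of `σ`. -/
def insertFirst {n : ℕ} (k : Fin (n + 1)) (σ : Equiv.Perm (Fin n)) : Equiv.Perm (Fin (n + 1)) :=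
  (finSuccEquiv n).trans (σ.optionCongr.trans (finSuccEquiv' k).symm)

@[simp]
theorem insertFirst_zero {n : ℕ} (k : Fin (n + 1)) (σ : Equiv.Perm (Fin n)) :
    insertFirst k σ 0 = k := by
  simp [insertFirst]

@[simp]
theorem insertFirst_succ {n : ℕ} (k : Fin (n + 1)) (σ : Equiv.Perm (Fin n)) (i : Fin n) :
    insertFirst k σ i.succ = k.succAbove (σ i) := by
  simp [insertFirst]

theorem insertFirst_injective {n : ℕ} (k : Fin (n + 1)) :
    Function.Injective (insertFirst k) := by
  intro σ τ h
  ext i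
  have := DFunLike.congr_fun h i.succ
  simp only [insertFirst_succ] at this
  rw [Fin.succAbove_right_injective this]

theorem exists_insertFirst {n : ℕ} (π : Equiv.Perm (Fin (n + 1))) :
    ∃ σ, insertFirst (π 0) σ = π := by
  have hne (i : Fin n) : ∃ j, (π 0).succAbove j = π i.succ :=
    Fin.exists_succAbove_eq (fun h => Fin.succ_ne_zero i (π.injective h))
  choose f hf using hne
  have hinj : Function.Injective f := by
    intro i j h
    have : π i.succ = π j.succ := by rw [← hf, ← hf, h]
    exact Fin.succ_injective _ (π.injective this)
  refine ⟨Equiv.ofBijective f (Finite.injective_iff_bijective.1 hinj), ?_⟩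
  ext i
  cases i using Fin.cases <;> simp [hf]

/-- Removing the first entry shifts the parity of positions, which swaps the two alternation
patterns; the initial descent survives as a bound on the next value. -/
theorem isAlternating_insertFirst {n : ℕ} (k : Fin (n + 2)) (σ : Equiv.Perm (Fin (n + 1))) :
    IsAlternating (insertFirst k σ) ↔ IsReverseAlternating σ ∧ (σ 0 : ℕ) < k := by
  have key (x : Fin (n + 1)) : k.succAbove x < k ↔ (x : ℕ) < k := by
    rw [Fin.succAbove_lt_iff_castSucc_lt, Fin.lt_def]
    rfl
  constructor
  · intro h
    refine ⟨fun i j hij => ?_, ?_⟩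
    · have := h i.succ j.succ (by simp [hij])
      simpa [Nat.even_add_one, Nat.odd_add_one, and_comm] using this
    · have := (h 0 (Fin.succ 0) (by simp)).1 (by simp)
      rw [insertFirst_zero, insertFirst_succ, key] at this
      exact this
  · rintro ⟨h, h0⟩ i j hij
    cases j using Fin.cases with
    | zero => simp at hij
    | succ j =>
      cases i using Fin.cases with
      | zero =>
        have hj : j = 0 := by
          ext; simpa using hij
        subst hj
        refine ⟨fun _ => ?_, fun ho => by simp at ho⟩
        rw [insertFirst_zero, insertFirst_succ, key]
        exact h0
      | succ i =>
        have := h i j (by simpa using hij)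
        simpa [Nat.even_add_one, Nat.odd_add_one, and_comm] using this

/-- The number of alternating permutations of `n + 1` elements with first value `k`
(an Entringer number). -/
noncomputable def alternatingCount (n k : ℕ) : ℕ :=
  Nat.card {π : Equiv.Perm (Fin (n + 1)) // IsAlternating π ∧ (π 0 : ℕ) = k}

/-- The number of reverse alternating permutations of `n + 1` elements with first value
less than `k`. -/
noncomputable def reverseAlternatingCount (n k : ℕ) : ℕ :=
  Nat.card {π : Equiv.Perm (Fin (n + 1)) // IsReverseAlternating π ∧ (π 0 : ℕ) < k}

theorem alternatingCount_succ (n k : ℕ) (hk : k ≤ n + 1) :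
    alternatingCount (n + 1) k = reverseAlternatingCount n k := by
  let K : Fin (n + 2) := ⟨k, by omega⟩
  symm
  refine Nat.card_congr (Equiv.ofBijective
    (fun σ => ⟨insertFirst K σ.1, (isAlternating_insertFirst K σ.1).2 σ.2, by simp [K]⟩) ⟨?_, ?_⟩)
  · intro σ τ h
    exact Subtype.ext (insertFirst_injective K (congrArg Subtype.val h))
  · rintro ⟨π, hπ, h0⟩
    obtain ⟨σ, hσ⟩ := exists_insertFirst π
    have hK : π 0 = K := Fin.ext h0
    rw [hK] at hσ
    subst hσ
    exact ⟨⟨σ, (isAlternating_insertFirst K σ).1 hπ⟩, rfl⟩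

theorem isAlternating_trans_rev {n : ℕ} (σ : Equiv.Perm (Fin n)) :
    IsAlternating (σ.trans Fin.revPerm) ↔ IsReverseAlternating σ := by
  simp [IsAlternating, IsReverseAlternating]

/-- Complementing the values of a permutation. -/
def complementEquiv (n : ℕ) : Equiv.Perm (Fin n) ≃ Equiv.Perm (Fin n) where
  toFun σ := σ.trans Fin.revPerm
  invFun σ := σ.trans Fin.revPerm
  left_inv σ := by ext; simp
  right_inv σ := by ext; simp

theorem card_reverseAlternating_first_eq (n k : ℕ) (hk : k ≤ n) :
    Nat.card {π : Equiv.Perm (Fin (n + 1)) // IsReverseAlternating π ∧ (π 0 : ℕ) = k} =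
      alternatingCount n (n - k) := by
  refine Nat.card_congr ((complementEquiv (n + 1)).subtypeEquiv fun σ => ?_)
  have : ((σ 0 : ℕ) = k) ↔ n - (σ 0 : ℕ) = n - k := by have := (σ 0).is_lt; omega
  simp [complementEquiv, isAlternating_trans_rev, this]

theorem reverseAlternatingCount_zero (n : ℕ) : reverseAlternatingCount n 0 = 0 := by
  simp [reverseAlternatingCount]

theorem reverseAlternatingCount_succ (n k : ℕ) (hk : k ≤ n) :
    reverseAlternatingCount n (k + 1) =
      reverseAlternatingCount n k + alternatingCount n (n - k) := by
  classical
  rw [← card_reverseAlternating_first_eq n k hk]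
  simp only [reverseAlternatingCount, Nat.card_eq_fintype_card, Fintype.card_subtype]
  rw [← Finset.card_union_of_disjoint]
  · congr 1
    ext π
    simp only [Finset.mem_filter, Finset.mem_univ, true_and, Finset.mem_union, ← and_or_left]
    rw [Nat.lt_succ_iff_lt_or_eq]
  · rw [Finset.disjoint_left]
    intro π h1 h2
    simp only [Finset.mem_filter, Finset.mem_univ, true_and] at h1 h2
    omega

theorem eulerNumber_succ (n : ℕ) :
    eulerNumber (n + 1) = reverseAlternatingCount n (n + 1) := by
  symm
  refine Nat.card_congr ((complementEquiv (n + 1)).subtypeEquiv fun σ => ?_)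
  simp only [complementEquiv, Equiv.coe_fn_mk, isAlternating_trans_rev, (σ 0).is_lt, and_true]

theorem eulerNumber_zero : eulerNumber 0 = 1 := by
  rw [eulerNumber, Nat.card_eq_one_iff_unique]
  exact ⟨⟨fun a b => Subtype.ext (Subsingleton.elim _ _)⟩, ⟨⟨1, fun i => i.elim0⟩⟩⟩

theorem alternatingCount_zero_zero : alternatingCount 0 0 = 1 := by
  rw [alternatingCount, Nat.card_eq_one_iff_unique]
  exact ⟨⟨fun a b => Subtype.ext (Equiv.ext fun i => Subsingleton.elim (α := Fin 1) _ _)⟩,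
    ⟨⟨1, fun i j h => by omega, by simp⟩⟩⟩

theorem alternatingCount_self (n : ℕ) : alternatingCount n n = eulerNumber n := by
  cases n with
  | zero => rw [alternatingCount_zero_zero, eulerNumber_zero]
  | succ n => rw [alternatingCount_succ n _ le_rfl, eulerNumber_succ]

theorem alternatingCount_succ_zero (n : ℕ) : alternatingCount (n + 1) 0 = 0 := by
  rw [alternatingCount_succ n 0 (by omega), reverseAlternatingCount_zero]

theorem alternatingCount_succ_succ (n k : ℕ) (hk : k ≤ n) :
    alternatingCount (n + 1) (k + 1) =
      alternatingCount (n + 1) k + alternatingCount n (n - k) := by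
  rw [alternatingCount_succ n _ (by omega), alternatingCount_succ n _ (by omega),
    reverseAlternatingCount_succ n k hk]

end EulerLogConvex

/-! ### Seidel array and the generating function `sec + tan` -/

namespace EulerLogConvex

/-- Row-by-row computation of the Entringer numbers. -/
def entringer : ℕ → ℕ → ℕ
  | 0, _ => 1
  | n + 1, k => ∑ j ∈ Finset.range k, entringer n (n - j)

/-- The bound `k ≤ n` matters: `entringer 0 k` is 1 for every `k`, but row `n + 1` reads row `n`
only at indices at most `n`. -/
theorem alternatingCount_eq_entringer (n k : ℕ) (hk : k ≤ n) :
    alternatingCount n k = entringer n k := by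
  induction n generalizing k with
  | zero =>
    obtain rfl : k = 0 := by omega
    rw [alternatingCount_zero_zero, entringer]
  | succ n ih =>
    induction k with
    | zero => simp [alternatingCount_succ_zero, entringer]
    | succ k ihk =>
      rw [alternatingCount_succ_succ n k (by omega), ihk (by omega), ih (n - k) (by omega),
        entringer, entringer, Finset.sum_range_succ]

theorem eulerNumber_eq_entringer (n : ℕ) : eulerNumber n = entringer n n := by
  rw [← alternatingCount_self, alternatingCount_eq_entringer n n le_rfl]

/-- The Seidel array: the Entringer triangle read in boustrophedon order, with signs. -/
noncomputable def seidel (i j : ℕ) : ℝ :=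
  (-1) ^ ((i + j) / 2) * alternatingCount (i + j) (if Even (i + j) then j else i)

/-- This is the Entringer recurrence; the parity of `i + j` decides which of the two neighbours is
the longer sum, and the signs absorb the difference. -/
theorem seidel_succ (i j : ℕ) : seidel (i + 1) j = seidel i (j + 1) + seidel i j := by
  rcases Nat.even_or_odd' (i + j) with ⟨m, hm | hm⟩
  · have h := alternatingCount_succ_succ (i + j) i (by omega)
    rw [show i + j - i = j by omega] at h
    have e1 : ¬ Even (i + j + 1) := by rw [Nat.not_even_iff]; omega
    have e2 : Even (i + j) := by rw [Nat.even_iff]; omega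
    simp only [seidel, show i + 1 + j = i + j + 1 by omega, show i + (j + 1) = i + j + 1 by omega,
      e1, e2, if_true, if_false, h, show (i + j + 1) / 2 = (i + j) / 2 by omega]
    push_cast
    ring
  · have h := alternatingCount_succ_succ (i + j) j (by omega)
    rw [show i + j - j = i by omega] at h
    have e1 : Even (i + j + 1) := by rw [Nat.even_iff]; omega
    have e2 : ¬ Even (i + j) := by rw [Nat.not_even_iff]; omega
    simp only [seidel, show i + 1 + j = i + j + 1 by omega, show i + (j + 1) = i + j + 1 by omega,
      e1, e2, if_true, if_false, h, show (i + j + 1) / 2 = (i + j) / 2 + 1 by omega]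
    push_cast
    ring

theorem seidel_eq_sum (i j : ℕ) :
    seidel i j = ∑ p ∈ Finset.HasAntidiagonal.antidiagonal i, (i.choose p.1 : ℝ) * seidel 0 (j + p.1) := by
  induction i generalizing j with
  | zero => simp
  | succ i ih =>
    rw [Finset.sum_antidiagonal_choose_succ_mul (fun p _ => seidel 0 (j + p)) i, seidel_succ,
      ih, ih, add_comm]
    congr 1
    refine Finset.sum_congr rfl fun p hp => ?_
    rw [Nat.choose_symm_of_eq_add (Finset.HasAntidiagonal.mem_antidiagonal.1 hp).symm, add_assoc, add_comm 1]

theorem seidel_zero_left (p : ℕ) :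
    seidel 0 p = if Even p then (-1) ^ (p / 2) * (eulerNumber p : ℝ) else 0 := by
  rcases p with _ | p
  · simp [seidel, alternatingCount_self]
  · simp only [seidel, zero_add, alternatingCount_succ_zero, apply_ite (alternatingCount (p + 1)),
      alternatingCount_self]
    split_ifs <;> simp

theorem seidel_zero_right (i : ℕ) :
    seidel i 0 = if Even i then (if i = 0 then 1 else 0)
      else (-1) ^ (i / 2) * (eulerNumber i : ℝ) := by
  rcases i with _ | i
  · simp [seidel, alternatingCount_zero_zero]
  · simp only [seidel, add_zero, alternatingCount_succ_zero, apply_ite (alternatingCount (i + 1)),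
      alternatingCount_self]
    split_ifs <;> simp_all

/-- The exponential generating function of the Euler numbers of even index. -/
noncomputable def secSeries : PowerSeries ℝ :=
  PowerSeries.mk fun n => if Even n then (eulerNumber n : ℝ) / n.factorial else 0

/-- The exponential generating function of the Euler numbers of odd index. -/
noncomputable def tanSeries : PowerSeries ℝ :=
  PowerSeries.mk fun n => if Even n then 0 else (eulerNumber n : ℝ) / n.factorial

theorem seidel_term (p q : ℕ) (hp : Even p) :
    (eulerNumber p : ℝ) / p.factorial * ((-1) ^ (q / 2) / q.factorial) =
      (-1) ^ ((p + q) / 2) / (p + q).factorial *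
        (((p + q).choose p : ℝ) * ((-1) ^ (p / 2) * (eulerNumber p : ℝ))) := by
  obtain ⟨m, rfl⟩ := hp
  rw [Nat.cast_add_choose, show (m + m + q) / 2 = m + q / 2 by omega,
    show (m + m) / 2 = m by omega, pow_add]
  have h : ((-1 : ℝ) ^ m) * (-1) ^ m = 1 := by rw [← mul_pow]; simp
  have h1 := Nat.cast_ne_zero (R := ℝ).2 (m + m).factorial_ne_zero
  have h2 := Nat.cast_ne_zero (R := ℝ).2 q.factorial_ne_zero
  have h3 := Nat.cast_ne_zero (R := ℝ).2 (m + m + q).factorial_ne_zero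
  field_simp
  linear_combination -(eulerNumber (m + m) : ℝ) * h

theorem sum_seidel (i : ℕ) :
    ∑ p ∈ Finset.HasAntidiagonal.antidiagonal i, (-1) ^ (i / 2) / (i.factorial : ℝ) *
      ((i.choose p.1 : ℝ) * (if Even p.1 then (-1) ^ (p.1 / 2) * (eulerNumber p.1 : ℝ) else 0)) =
      (-1) ^ (i / 2) / (i.factorial : ℝ) * seidel i 0 := by
  rw [seidel_eq_sum, Finset.mul_sum]
  simp only [zero_add, seidel_zero_left]

/-- Column 0 of the Seidel array is the binomial transform of row 0. Its even entries vanish beyond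
the first, which gives this identity; its odd entries give `secSeries_mul_sin`. -/
theorem secSeries_mul_cos : secSeries * PowerSeries.cos ℝ = 1 := by
  ext i
  rw [PowerSeries.coeff_mul, PowerSeries.coeff_one]
  by_cases hi : Even i
  · have h := sum_seidel i
    rw [seidel_zero_right, if_pos hi] at h
    trans (-1) ^ (i / 2) / (i.factorial : ℝ) * (if i = 0 then 1 else 0)
    · rw [← h]
      refine Finset.sum_congr rfl fun p hp => ?_
      obtain ⟨p, q⟩ := p
      obtain rfl := Finset.HasAntidiagonal.mem_antidiagonal.1 hp
      simp only [secSeries, PowerSeries.cos, PowerSeries.coeff_mk]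
      by_cases hp : Even p
      · have hq : Even q := (Nat.even_add.1 hi).1 hp
        rw [if_pos hp, if_pos hq, if_pos hp, ← seidel_term p q hp]
        simp
      · simp [hp]
    · split_ifs with h0 <;> simp [h0]
  · rw [if_neg (by rintro rfl; simp at hi)]
    refine Finset.sum_eq_zero fun p hp => ?_
    obtain ⟨p, q⟩ := p
    obtain rfl := Finset.HasAntidiagonal.mem_antidiagonal.1 hp
    simp only [secSeries, PowerSeries.cos, PowerSeries.coeff_mk]
    rw [Nat.even_add] at hi
    by_cases hp : Even p <;> simp_all

theorem secSeries_mul_sin : secSeries * PowerSeries.sin ℝ = tanSeries := by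
  ext i
  rw [PowerSeries.coeff_mul, tanSeries, PowerSeries.coeff_mk]
  by_cases hi : Even i
  · rw [if_pos hi]
    refine Finset.sum_eq_zero fun p hp => ?_
    obtain ⟨p, q⟩ := p
    obtain rfl := Finset.HasAntidiagonal.mem_antidiagonal.1 hp
    simp only [secSeries, PowerSeries.sin, PowerSeries.coeff_mk]
    rw [Nat.even_add] at hi
    by_cases hp : Even p <;> simp_all
  · have h := sum_seidel i
    rw [seidel_zero_right, if_neg hi] at h
    rw [if_neg hi]
    trans (-1) ^ (i / 2) / (i.factorial : ℝ) * ((-1) ^ (i / 2) * (eulerNumber i : ℝ))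
    · rw [← h]
      refine Finset.sum_congr rfl fun p hp => ?_
      obtain ⟨p, q⟩ := p
      obtain rfl := Finset.HasAntidiagonal.mem_antidiagonal.1 hp
      simp only [secSeries, PowerSeries.sin, PowerSeries.coeff_mk]
      by_cases hp : Even p
      · have hq : ¬ Even q := fun hq => hi (hp.add hq)
        rw [if_pos hp, if_neg hq, if_pos hp, ← seidel_term p q hp]
        simp
      · simp [hp]
    · have h : ((-1 : ℝ) ^ (i / 2)) * (-1) ^ (i / 2) = 1 := by rw [← mul_pow]; simp
      field_simp
      linear_combination (eulerNumber i : ℝ) * h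

/-- The exponential generating function of the Euler numbers is `sec + tan`. -/
theorem eulerSeries_mul_cos :
    (PowerSeries.mk fun n => (eulerNumber n : ℝ) / n.factorial) * PowerSeries.cos ℝ =
      1 + PowerSeries.sin ℝ := by
  have h : (PowerSeries.mk fun n => (eulerNumber n : ℝ) / n.factorial) =
      secSeries + tanSeries := by
    ext n
    simp only [secSeries, tanSeries, PowerSeries.coeff_mk, map_add]
    split_ifs <;> simp
  rw [h, add_mul, ← secSeries_mul_sin, mul_right_comm, secSeries_mul_cos, one_mul]

theorem eulerNumber_values : eulerNumber 1 = 1 ∧ eulerNumber 2 = 1 ∧ eulerNumber 3 = 2 ∧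
    eulerNumber 4 = 5 ∧ eulerNumber 5 = 16 ∧ eulerNumber 6 = 61 ∧ eulerNumber 7 = 272 ∧
    eulerNumber 8 = 1385 ∧ eulerNumber 9 = 7936 ∧ eulerNumber 10 = 50521 := by
  simp [eulerNumber_eq_entringer, entringer, Finset.sum_range_succ]

end EulerLogConvex

/-! ### Pole expansion of `sec + tan` -/

namespace EulerLogConvex

open Real

/-- The contribution of the pair of poles `4k+5`, `-(4k+3)` to the `n`-th coefficient of
`sec + tan` (after rescaling the variable). -/
noncomputable def poleTerm (n k : ℕ) : ℝ :=
  1 / (4 * k + 5 : ℝ) ^ (n + 1) + 1 / (-(4 * k + 3) : ℝ) ^ (n + 1)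

theorem abs_poleTerm_le (n k : ℕ) :
    |poleTerm n k| ≤ 2 / 3 ^ (n + 1) * (1 / ((k : ℝ) + 1) ^ 2) := by
  have hk : (0 : ℝ) ≤ k := k.cast_nonneg
  rcases n with _ | n
  · have h : poleTerm 0 k = -(2 / ((4 * k + 5) * (4 * k + 3))) := by
      rw [poleTerm]
      simp only [zero_add, pow_one]
      rw [div_neg]
      field_simp
      ring
    rw [h, abs_neg, abs_of_nonneg (by positivity), div_mul_div_comm, mul_one, zero_add, pow_one]
    exact div_le_div_of_nonneg_left (by norm_num) (by positivity) (by nlinarith)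
  · have h3 : (3 : ℝ) ^ (n + 2) * ((k : ℝ) + 1) ^ 2 ≤ (4 * k + 3) ^ (n + 2) := by
      calc (3 : ℝ) ^ (n + 2) * ((k : ℝ) + 1) ^ 2 = 3 ^ n * (3 * ((k : ℝ) + 1)) ^ 2 := by ring
        _ ≤ (4 * (k : ℝ) + 3) ^ n * (4 * (k : ℝ) + 3) ^ 2 := by gcongr <;> linarith
        _ = _ := by ring
    have h5 : (3 : ℝ) ^ (n + 2) * ((k : ℝ) + 1) ^ 2 ≤ (4 * k + 5) ^ (n + 2) :=
      h3.trans (by gcongr; norm_num)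
    calc |poleTerm (n + 1) k| ≤ 1 / (4 * k + 5) ^ (n + 2) + 1 / (4 * k + 3) ^ (n + 2) := by
          refine (abs_add_le _ _).trans (le_of_eq ?_)
          rw [abs_div, abs_div, abs_pow, abs_pow, abs_neg, abs_one,
            abs_of_nonneg (by positivity : (0 : ℝ) ≤ 4 * k + 5),
            abs_of_nonneg (by positivity : (0 : ℝ) ≤ 4 * k + 3)]
      _ ≤ 1 / ((3 : ℝ) ^ (n + 2) * ((k : ℝ) + 1) ^ 2) +
            1 / ((3 : ℝ) ^ (n + 2) * ((k : ℝ) + 1) ^ 2) := by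
          gcongr
      _ = _ := by
          field_simp
          ring

theorem hasSum_one_div_succ_sq :
    HasSum (fun k : ℕ => 1 / ((k : ℝ) + 1) ^ 2) (π ^ 2 / 6) := by
  have h := (hasSum_nat_add_iff' (f := fun k : ℕ => 1 / (k : ℝ) ^ 2) 1).2 hasSum_zeta_two
  simpa using h

theorem summable_poleTerm (n : ℕ) : Summable (poleTerm n) :=
  Summable.of_norm_bounded (hasSum_one_div_succ_sq.summable.mul_left _) (abs_poleTerm_le n)

theorem abs_tsum_poleTerm_le (n : ℕ) : |∑' k, poleTerm n k| ≤ 4 / 3 ^ (n + 1) := by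
  have h := tsum_of_norm_bounded (f := poleTerm n)
    (hasSum_one_div_succ_sq.mul_left (2 / 3 ^ (n + 1))) (abs_poleTerm_le n)
  rw [Real.norm_eq_abs] at h
  refine h.trans ?_
  have h2 : π ^ 2 ≤ 12 := by nlinarith [pi_gt_three, pi_lt_d2]
  rw [div_mul_eq_mul_div]
  gcongr
  linarith

theorem hasSum_pow_mul_poleTerm {s : ℝ} (hs : |s| < 1) (k : ℕ) :
    HasSum (fun n => s ^ n * poleTerm n k)
      (1 / (4 * k + 5 - s) + 1 / (-(4 * k + 3) - s)) := by
  have geom (c : ℝ) (hc : 1 ≤ |c|) : HasSum (fun n => s ^ n * (1 / c ^ (n + 1))) (1 / (c - s)) := by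
    have hc0 : c ≠ 0 := by rintro rfl; norm_num at hc
    have h1 : |s / c| < 1 := by
      rw [abs_div, div_lt_one (by linarith)]
      linarith
    have hcs : c - s ≠ 0 := by
      rw [sub_ne_zero]
      rintro rfl
      linarith
    have e : 1 / (c - s) = 1 / c * (1 - s / c)⁻¹ := by
      rw [one_div, one_div, ← mul_inv, mul_sub, mul_one, mul_div_cancel₀ _ hc0]
    rw [e]
    refine ((hasSum_geometric_of_abs_lt_one h1).mul_left (1 / c)).congr_fun fun n => ?_
    rw [div_pow]
    field_simp
    ring
  have hk : (0 : ℝ) ≤ k := k.cast_nonneg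
  simp only [poleTerm, mul_add]
  refine (geom _ ?_).add (geom _ ?_)
  · rw [abs_of_nonneg] <;> linarith
  · rw [abs_neg, abs_of_nonneg] <;> linarith

/-- The double series is dominated by `|s|^n / (k+1)^2`, so the order of summation may be exchanged.
-/
theorem hasSum_pow_mul_tsum_poleTerm {s : ℝ} (hs : |s| < 1) :
    HasSum (fun n => s ^ n * ∑' k, poleTerm n k)
      (∑' k : ℕ, (1 / (4 * k + 5 - s) + 1 / (-(4 * k + 3) - s))) := by
  have hsum : Summable fun p : ℕ × ℕ => s ^ p.1 * poleTerm p.1 p.2 := by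
    refine Summable.of_norm_bounded (Summable.mul_of_nonneg
      (summable_geometric_of_lt_one (abs_nonneg s) hs) hasSum_one_div_succ_sq.summable
      (fun n => by positivity) (fun k => by positivity)) ?_
    rintro ⟨n, k⟩
    simp only [norm_mul, norm_pow, Real.norm_eq_abs]
    gcongr
    refine (abs_poleTerm_le n k).trans (mul_le_of_le_one_left (by positivity) ?_)
    rw [div_le_one (by positivity)]
    calc (2 : ℝ) ≤ 3 ^ 1 := by norm_num
      _ ≤ 3 ^ (n + 1) := pow_le_pow_right₀ (by norm_num) (by omega)
  have h1 := hsum.hasSum.prod_fiberwise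
    (fun n => (summable_poleTerm n).hasSum.mul_left (s ^ n))
  have h2 := (((Equiv.prodComm ℕ ℕ).hasSum_iff).2 hsum.hasSum).prod_fiberwise
    (fun k => hasSum_pow_mul_poleTerm hs k)
  rw [h2.tsum_eq]
  exact h1

theorem pi_mul_cot_eq {z : ℝ} (h0 : 0 < z) (h1 : z < 1) :
    π * (cos (π * z) / sin (π * z)) =
      1 / z + ∑' k : ℕ, (1 / (z - (k + 1)) + 1 / (z + (k + 1))) := by
  have hz : (z : ℂ) ∈ Complex.integerComplement := by
    rintro ⟨m, hm⟩
    have hm' : (m : ℝ) = z := by exact_mod_cast hm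
    rw [← hm'] at h0 h1
    have : 0 < m := by exact_mod_cast h0
    have : m < 1 := by exact_mod_cast h1
    omega
  have h := cot_series_rep' hz
  rw [Complex.cot] at h
  rw [← sub_eq_iff_eq_add']
  exact_mod_cast h

/-- Mittag-Leffler expansion of `π cot (π z)` at `z = (1 - s)/4`: the term `1/z` is the dominant
pole `s = 1`, and the terms `z ± (k+1)` give the poles `4k+5` and `-(4k+3)`. -/
theorem hasSum_cot {s : ℝ} (hs : |s| < 1) :
    HasSum (fun n => s ^ n * (4 * (1 + ∑' k, poleTerm n k)))
      (π * (cos (π * ((1 - s) / 4)) / sin (π * ((1 - s) / 4)))) := by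
  obtain ⟨hs1, hs2⟩ := abs_lt.1 hs
  rw [pi_mul_cot_eq (by linarith) (by linarith)]
  have h := ((hasSum_geometric_of_abs_lt_one hs).add (hasSum_pow_mul_tsum_poleTerm hs)).mul_left 4
  have e : 1 / ((1 - s) / 4) +
      ∑' k : ℕ, (1 / ((1 - s) / 4 - (k + 1)) + 1 / ((1 - s) / 4 + (k + 1))) =
      4 * ((1 - s)⁻¹ + ∑' k : ℕ, (1 / (4 * k + 5 - s) + 1 / (-(4 * k + 3) - s))) := by
    rw [mul_add, ← tsum_mul_left]
    congr 1
    · rw [one_div_div]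
      rfl
    · refine tsum_congr fun k => ?_
      rw [mul_add, add_comm, mul_one_div, mul_one_div,
        show (1 - s) / 4 + ((k : ℝ) + 1) = (4 * k + 5 - s) / 4 by ring,
        show (1 - s) / 4 - ((k : ℝ) + 1) = (-(4 * k + 3) - s) / 4 by ring, one_div_div, one_div_div]
  rw [e]
  exact h.congr_fun fun n => by ring

theorem cot_mul_cos {x : ℝ} (hx : |x| < π / 2) :
    cos (π / 4 - x / 2) / sin (π / 4 - x / 2) * cos x = 1 + sin x := by
  obtain ⟨h1, h2⟩ := abs_lt.1 hx
  have hs : sin (π / 4 - x / 2) ≠ 0 := (sin_pos_of_pos_of_lt_pi (by linarith) (by linarith)).ne'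
  have hc : cos x = 2 * (sin (π / 4 - x / 2) * cos (π / 4 - x / 2)) := by
    rw [← mul_assoc, ← sin_two_mul, ← sin_pi_div_two_sub]
    congr 1
    ring
  have hsin : sin x = 2 * cos (π / 4 - x / 2) ^ 2 - 1 := by
    rw [← cos_two_mul, ← cos_pi_div_two_sub]
    congr 1
    ring
  rw [hsin, hc, div_mul_eq_mul_div, div_eq_iff hs]
  ring

/-- The normalized Euler number `E_n / n!`, as a sum over the poles of `sec + tan`. -/
noncomputable def poleCoeff (n : ℕ) : ℝ :=
  4 / π * (2 / π) ^ n * (1 + ∑' k, poleTerm n k)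

theorem hasSum_poleCoeff {x : ℝ} (hx : |x| < 1) :
    HasSum (fun n => poleCoeff n * x ^ n) (cos (π / 4 - x / 2) / sin (π / 4 - x / 2)) := by
  have hpi := pi_pos
  have hs : |2 / π * x| < 1 := by
    rw [abs_mul, abs_of_pos (by positivity)]
    refine mul_lt_one_of_nonneg_of_lt_one_right ?_ (abs_nonneg x) hx
    rw [div_le_one hpi]
    exact pi_gt_three.le.trans' (by norm_num)
  have e : π * ((1 - 2 / π * x) / 4) = π / 4 - x / 2 := by
    field_simp
    ring
  have h := (hasSum_cot hs).mul_left (1 / π)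
  rw [e] at h
  rw [← mul_assoc, one_div_mul_cancel hpi.ne', one_mul] at h
  refine h.congr_fun fun n => ?_
  rw [poleCoeff]
  ring

theorem hasSum_coeff_cos (x : ℝ) :
    HasSum (fun n => PowerSeries.coeff n (PowerSeries.cos ℝ) * x ^ n) (cos x) := by
  have h := Real.hasSum_cos x
  rw [← add_zero (cos x)]
  refine HasSum.even_add_odd ?_ ?_
  · convert h using 2 with n
    simp [PowerSeries.cos]
    ring
  · convert hasSum_zero using 2 with n
    simp [PowerSeries.cos]

theorem hasSum_coeff_sin (x : ℝ) :
    HasSum (fun n => PowerSeries.coeff n (PowerSeries.sin ℝ) * x ^ n) (sin x) := by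
  have h := Real.hasSum_sin x
  rw [← zero_add (sin x)]
  refine HasSum.even_add_odd ?_ ?_
  · convert hasSum_zero using 2 with n
    simp [PowerSeries.sin]
  · convert h using 2 with n
    simp [PowerSeries.sin, show (2 * n + 1) / 2 = n by omega]
    ring

/-- A power series is determined by its values near zero. -/
theorem powerSeries_ext_of_hasSum {A B : PowerSeries ℝ} {f : ℝ → ℝ}
    (hA : ∀ x : ℝ, |x| < 1 → HasSum (fun n => PowerSeries.coeff n A * x ^ n) (f x))
    (hB : ∀ x : ℝ, |x| < 1 → HasSum (fun n => PowerSeries.coeff n B * x ^ n) (f x)) : A = B := by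
  have key {A : PowerSeries ℝ}
      (hA : ∀ x : ℝ, |x| < 1 → HasSum (fun n => PowerSeries.coeff n A * x ^ n) (f x)) :
      HasFPowerSeriesAt f
        (FormalMultilinearSeries.ofScalars ℝ fun n => PowerSeries.coeff n A) 0 := by
    rw [hasFPowerSeriesAt_iff, Metric.eventually_nhds_iff]
    refine ⟨1, one_pos, fun x hx => ?_⟩
    rw [dist_zero_right, Real.norm_eq_abs] at hx
    simpa [FormalMultilinearSeries.coeff_ofScalars, mul_comm] using hA x hx
  ext n
  have h := (key hA).eq_formalMultilinearSeries (key hB)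
  simpa using congrArg (fun p => p.coeff n) h

theorem hasSum_coeff_mul {A B : PowerSeries ℝ} {x a b : ℝ}
    (hA : HasSum (fun n => PowerSeries.coeff n A * x ^ n) a)
    (hB : HasSum (fun n => PowerSeries.coeff n B * x ^ n) b) :
    HasSum (fun n => PowerSeries.coeff n (A * B) * x ^ n) (a * b) := by
  have hA' := hA.summable.norm
  have hB' := hB.summable.norm
  have h := tsum_mul_tsum_eq_tsum_sum_antidiagonal_of_summable_norm hA' hB'
  have hs := (summable_norm_sum_mul_antidiagonal_of_summable_norm hA' hB').of_norm.hasSum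
  rw [← h, hA.tsum_eq, hB.tsum_eq] at hs
  refine hs.congr_fun fun n => ?_
  rw [PowerSeries.coeff_mul, Finset.sum_mul]
  refine Finset.sum_congr rfl fun p hp => ?_
  rw [← Finset.HasAntidiagonal.mem_antidiagonal.1 hp, pow_add]
  ring

theorem poleSeries_mul_cos :
    PowerSeries.mk poleCoeff * PowerSeries.cos ℝ = 1 + PowerSeries.sin ℝ := by
  refine powerSeries_ext_of_hasSum (f := fun x => 1 + sin x) (fun x hx => ?_) fun x _ => ?_
  · have hx' : |x| < π / 2 := hx.trans (by linarith [pi_gt_three])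
    rw [← cot_mul_cos hx']
    refine hasSum_coeff_mul ?_ (hasSum_coeff_cos x)
    simpa using hasSum_poleCoeff hx
  · simp only [map_add, add_mul]
    refine HasSum.add ?_ (hasSum_coeff_sin x)
    convert hasSum_single 0 ?_ using 1
    · simp
    · intro n hn
      simp [PowerSeries.coeff_one, hn]

theorem eulerNumber_eq (n : ℕ) : (eulerNumber n : ℝ) = n.factorial * poleCoeff n := by
  have h := eulerSeries_mul_cos.trans poleSeries_mul_cos.symm
  have hc : PowerSeries.cos ℝ ≠ 0 := by
    intro h0
    simpa [PowerSeries.cos] using congrArg (PowerSeries.coeff 0) h0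
  have h2 := congrArg (PowerSeries.coeff n) (mul_right_cancel₀ hc h)
  simp only [PowerSeries.coeff_mk] at h2
  rw [← h2]
  have := Nat.cast_ne_zero (R := ℝ).2 n.factorial_ne_zero
  field_simp

end EulerLogConvex

/-! ### Error estimates and conclusion -/

namespace EulerLogConvex

open Real

/-- The correction factor of `E_n / n!` relative to the contribution of the nearest pole. -/
noncomputable def poleCorrection (n : ℕ) : ℝ := 1 + ∑' k, poleTerm n k

/-- The first log-convexity defect of the Euler numbers, normalized. -/
noncomputable def normalizedDefect (n : ℕ) : ℝ :=
  (n + 3) * (poleCorrection (n + 1) * poleCorrection (n + 3)) -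
    (n + 2) * poleCorrection (n + 2) ^ 2

theorem eulerNumber_eq_poleCorrection (n : ℕ) :
    (eulerNumber n : ℝ) = n.factorial * (4 / π * (2 / π) ^ n * poleCorrection n) :=
  eulerNumber_eq n

theorem logConvexOp_eulerNumber (n : ℕ) :
    logConvexOp (fun n => (eulerNumber (n + 1) : ℝ)) n =
      (4 / π) ^ 2 * (2 / π) ^ (2 * n + 4) * ((n + 1).factorial * (n + 2).factorial) *
        normalizedDefect n := by
  simp only [logConvexOp, eulerNumber_eq_poleCorrection, normalizedDefect,
    Nat.factorial_succ (n + 2), Nat.factorial_succ (n + 1)]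
  push_cast
  ring

theorem logConvexOp_logConvexOp_eulerNumber (n : ℕ) :
    logConvexOp (logConvexOp (fun n => (eulerNumber (n + 1) : ℝ))) n =
      (4 / π) ^ 4 * (2 / π) ^ (4 * n + 12) *
        ((n + 1).factorial * (n + 2).factorial * (n + 3).factorial ^ 2) *
        ((n + 4) * (normalizedDefect n * normalizedDefect (n + 2)) -
          (n + 2) * normalizedDefect (n + 1) ^ 2) := by
  rw [logConvexOp]
  simp only [logConvexOp_eulerNumber, Nat.factorial_succ (n + 3), Nat.factorial_succ (n + 2),
    Nat.factorial_succ (n + 1)]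
  push_cast
  ring

theorem abs_poleCorrection_sub_one_le {j n : ℕ} (h : n ≤ j) :
    |poleCorrection j - 1| ≤ 4 / 3 ^ (n + 1) := by
  rw [poleCorrection, add_sub_cancel_left]
  refine (abs_tsum_poleTerm_le j).trans ?_
  gcongr
  norm_num

theorem abs_normalizedDefect_sub_one_le {j n : ℕ} (h : n ≤ j) (h' : j ≤ n + 2) :
    |normalizedDefect j - 1| ≤ 12 * (2 * n + 9) / 3 ^ (n + 2) := by
  set η : ℝ := 4 / 3 ^ (n + 2) with hη
  have h0 : 0 < η := by positivity
  have h1 : η ≤ 1 := by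
    rw [hη, div_le_one (by positivity)]
    calc (4 : ℝ) ≤ 3 ^ 2 := by norm_num
      _ ≤ 3 ^ (n + 2) := pow_le_pow_right₀ (by norm_num) (by omega)
  have ha := abs_poleCorrection_sub_one_le (show n + 1 ≤ j + 1 by omega)
  have hb := abs_poleCorrection_sub_one_le (show n + 1 ≤ j + 2 by omega)
  have hc := abs_poleCorrection_sub_one_le (show n + 1 ≤ j + 3 by omega)
  rw [← hη] at ha hb hc
  -- Each product of two corrections is within `3η` of 1; the weights `j+3 ≤ n+5` and `j+2 ≤ n+4`
  -- then add up to `2n+9`.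
  have key {x y : ℝ} (hx : |x - 1| ≤ η) (hy : |y - 1| ≤ η) : |x * y - 1| ≤ 3 * η := by
    calc |x * y - 1| = |(x - 1) * (y - 1) + (x - 1) + (y - 1)| := by ring_nf
      _ ≤ |x - 1| * |y - 1| + |x - 1| + |y - 1| := by
        rw [← abs_mul]
        exact (abs_add_le _ _).trans (add_le_add_left (abs_add_le _ _) _)
      _ ≤ η * 1 + η + η := by gcongr; exact hy.trans h1
      _ = 3 * η := by ring
  have hj : (j : ℝ) ≤ n + 2 := by exact_mod_cast h'
  calc |normalizedDefect j - 1|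
      = |(j + 3) * (poleCorrection (j + 1) * poleCorrection (j + 3) - 1) -
          (j + 2) * (poleCorrection (j + 2) * poleCorrection (j + 2) - 1)| := by
        rw [normalizedDefect]
        ring_nf
    _ ≤ |((j : ℝ) + 3) * (poleCorrection (j + 1) * poleCorrection (j + 3) - 1)| +
          |((j : ℝ) + 2) * (poleCorrection (j + 2) * poleCorrection (j + 2) - 1)| := abs_sub _ _
    _ ≤ (n + 5) * (3 * η) + (n + 4) * (3 * η) := by
        rw [abs_mul, abs_mul, abs_of_nonneg (by positivity : (0 : ℝ) ≤ j + 3),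
          abs_of_nonneg (by positivity : (0 : ℝ) ≤ j + 2)]
        exact add_le_add
          (mul_le_mul (by linarith) (key ha hc) (abs_nonneg _) (by positivity))
          (mul_le_mul (by linarith) (key hb hb) (abs_nonneg _) (by positivity))
    _ = _ := by
        rw [hη]
        ring

theorem polynomial_le_three_pow (n : ℕ) (hn : 6 ≤ n) :
    (24 * (n + 3) * (2 * n + 9) : ℝ) ≤ 3 ^ (n + 2) := by
  induction n, hn using Nat.le_induction with
  | base => norm_num
  | succ n hn ih =>
    have : (6 : ℝ) ≤ n := by exact_mod_cast hn
    rw [pow_succ]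
    push_cast
    nlinarith

/-- With `θ` the error bound on `D_n`, `(n+4)(1-θ)^2 - (n+2)(1+θ)^2 = 2 + 2θ^2 - 4(n+3)θ`, so
`2(n+3)θ ≤ 1` suffices. The inequality fails at `n = 5`, hence the threshold 6. -/
theorem defect_bound (n : ℕ) (hn : 6 ≤ n) :
    2 * (n + 3) * (12 * (2 * n + 9) / 3 ^ (n + 2) : ℝ) ≤ 1 := by
  rw [mul_div_assoc', div_le_one (by positivity)]
  linarith [polynomial_le_three_pow n hn]

theorem normalizedDefect_pos (n : ℕ) (hn : 6 ≤ n) : 0 < normalizedDefect n := by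
  have h := (abs_le.1 (abs_normalizedDefect_sub_one_le le_rfl (show n ≤ n + 2 by omega))).1
  have hb := defect_bound n hn
  set θ : ℝ := 12 * (2 * n + 9) / 3 ^ (n + 2)
  have h0 : 0 ≤ θ := by positivity
  nlinarith [n.cast_nonneg (α := ℝ)]

theorem normalizedDefect_second (n : ℕ) (hn : 6 ≤ n) :
    0 ≤ (n + 4) * (normalizedDefect n * normalizedDefect (n + 2)) -
      (n + 2) * normalizedDefect (n + 1) ^ 2 := by
  have h0 := abs_le.1 (abs_normalizedDefect_sub_one_le le_rfl (show n ≤ n + 2 by omega))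
  have h1 := abs_le.1 (abs_normalizedDefect_sub_one_le (show n ≤ n + 1 by omega)
    (show n + 1 ≤ n + 2 by omega))
  have h2 := abs_le.1 (abs_normalizedDefect_sub_one_le (show n ≤ n + 2 by omega) le_rfl)
  have hb := defect_bound n hn
  have hpos := normalizedDefect_pos (n + 1) (by omega)
  set θ : ℝ := 12 * (2 * n + 9) / 3 ^ (n + 2)
  have hθ : 0 ≤ θ := by positivity
  have hθ1 : θ ≤ 1 := by nlinarith [n.cast_nonneg (α := ℝ)]
  have hl : (1 - θ) * (1 - θ) ≤ normalizedDefect n * normalizedDefect (n + 2) :=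
    mul_le_mul (by linarith [h0.1]) (by linarith [h2.1]) (by linarith) (by linarith [h0.1])
  have hu : normalizedDefect (n + 1) ^ 2 ≤ (1 + θ) ^ 2 :=
    pow_le_pow_left₀ hpos.le (by linarith [h1.2]) 2
  have hl' := mul_le_mul_of_nonneg_left hl (by positivity : (0 : ℝ) ≤ n + 4)
  have hu' := mul_le_mul_of_nonneg_left hu (by positivity : (0 : ℝ) ≤ n + 2)
  nlinarith

theorem logConvexOp_eulerNumber_nonneg (n : ℕ) :
    0 ≤ logConvexOp (fun n => (eulerNumber (n + 1) : ℝ)) n := by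
  rcases le_or_gt 6 n with hn | hn
  · rw [logConvexOp_eulerNumber]
    have := normalizedDefect_pos n hn
    positivity
  · obtain ⟨h1, h2, h3, h4, h5, h6, h7, h8, h9, h10⟩ := eulerNumber_values
    interval_cases n <;> norm_num [logConvexOp, h1, h2, h3, h4, h5, h6, h7, h8]

theorem logConvexOp_logConvexOp_eulerNumber_nonneg (n : ℕ) :
    0 ≤ logConvexOp (logConvexOp (fun n => (eulerNumber (n + 1) : ℝ))) n := by
  rcases le_or_gt 6 n with hn | hn
  · rw [logConvexOp_logConvexOp_eulerNumber]
    exact mul_nonneg (by positivity) (normalizedDefect_second n hn)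
  · obtain ⟨h1, h2, h3, h4, h5, h6, h7, h8, h9, h10⟩ := eulerNumber_values
    interval_cases n <;> norm_num [logConvexOp, h1, h2, h3, h4, h5, h6, h7, h8, h9, h10]

end EulerLogConvex

theorem proposition4p2 :
    EulerLogConvex.IsKLogConvex 2
      (fun n : ℕ => (EulerLogConvex.eulerNumber (n + 1) : ℝ)) := by
  intro m hm n
  interval_cases m
  · exact Nat.cast_nonneg _
  · exact EulerLogConvex.logConvexOp_eulerNumber_nonneg n
  · exact EulerLogConvex.logConvexOp_logConvexOp_eulerNumber_nonneg n
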